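/- **Theorem 1.** A complex-valued neural network (CVNN) with $n$ inputs and $m$ outputs is a composition of complex affine layers $y\mapsto Wy+b$, all but the last followed by the entrywise activation $\mathbb{C}\mathrm{ReLU}(z)=\mathrm{ReLU}(\Re z)+i\,\mathrm{ReLU}(\Im z)$; a real-valued network (RVNN) is defined in the same way over $\mathbb{R}$ with $\mathrm{ReLU}$. The depth is the number of affine layers, and the width is the largest number of neurons in a layer. For $z\in\mathbb{C}^d$ put $\hat z=(\Re z,\Im z)\in\mathbb{R}^{2d}$. All norms and Lipschitz constants are Euclidean. Put $$B^{\mathbb C}(n,m,K,\varepsilon)=\Big(\frac{144mK^2(n+2)^2}{\varepsilon^2}+9\Big)^{2n},\qquad B^{\mathbb R}(n,m,K,\varepsilon)=2m\Big(\frac{2mK(1+n/2)}{\varepsilon}\Big)^{4n}.$$ There is an absolute constant $C>0$ such that the following holds for all integers $n\ge 1$ and all reals $K>0$, $\varepsilon>0$. 1. For every $m\ge 1$ and every $K$-Lipschitz $f:[-1,1]^n+i[-1,1]^n\to\mathbb{C}^m$: (a) there is a CVNN $\Phi^{\mathbb C}$ of width $2n+2m+1$ and depth $N^{\mathbb C}\le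 C\,B^{\mathbb C}(n,m,K,\varepsilon)$ with $\sup_z\|f(z)-\Phi^{\mathbb C}(z)\|\le\varepsilon$; (b) there is an RVNN $\Phi^{\mathbb R}$ of width $2n+2m+2$ and depth $N^{\mathbb R}\le C\max\{1,B^{\mathbb R}(n,m,K,\varepsilon)\}$ with $\sup_z\|\widehat{f(z)}-\Phi^{\mathbb R}(\hat z)\|\le\varepsilon$. 2. When the output dimension $m$ is sufficiently large and the other parameters are fixed, the depth order of the CVNN is smaller than that of the RVNN, whatever the implied constants: for every $c>0$ there is $M$ (depending on $n,K,\varepsilon,c$) such that $B^{\mathbb C}(n,m,K,\varepsilon)<c\,B^{\mathbb R}(n,m,K,\varepsilon)$ for all $m\ge M$. This compares upper bounds for the depths, not the minimal depths themselves. -/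

import Mathlib

open scoped NNReal

/-- A fully connected feed-forward network over `𝕜` with `a` inputs and `b` outputs: a finite
sequence of affine layers `y ↦ W y + β`.  Every layer but the last one (`output`) is followed by
the activation function, which is supplied on evaluation. -/
inductive FCN (𝕜 : Type) : ℕ → ℕ → Type
  | output {a b : ℕ} (W : Matrix (Fin b) (Fin a) 𝕜) (β : Fin b → 𝕜) : FCN 𝕜 a b
  | hidden {a h b : ℕ} (W : Matrix (Fin h) (Fin a) 𝕜) (β : Fin h → 𝕜) (next : FCN 𝕜 h b) :
      FCN 𝕜 a b

namespace FCN

/-- The number of affine layers. -/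
def depth {𝕜 : Type} : {a b : ℕ} → FCN 𝕜 a b → ℕ
  | _, _, output _ _ => 1
  | _, _, hidden _ _ next => next.depth + 1

/-- The largest number of neurons in a layer (input, hidden or output). -/
def width {𝕜 : Type} : {a b : ℕ} → FCN 𝕜 a b → ℕ
  | a, b, output _ _ => max a b
  | a, _, hidden _ _ next => max a next.width

/-- The function computed by the network when the activation function is `σ`, applied entrywise. -/
def eval {𝕜 : Type} [Semiring 𝕜] (σ : 𝕜 → 𝕜) :
    {a b : ℕ} → FCN 𝕜 a b → (Fin a → 𝕜) → (Fin b → 𝕜)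
  | _, _, output W β, x => W.mulVec x + β
  | _, _, hidden W β next, x => next.eval σ (fun i => σ ((W.mulVec x + β) i))

end FCN

/-- `ReLU(x) = max(x, 0)`. -/
noncomputable def relu (x : ℝ) : ℝ := max x 0

/-- `ℂReLU(z) = ReLU(Re z) + i ReLU(Im z)`. -/
noncomputable def crelu (z : ℂ) : ℂ := ⟨relu z.re, relu z.im⟩

/-- The function `ℂⁿ → ℂᵐ` computed by a complex-valued network (CVNN). -/
noncomputable def cvnn {n m : ℕ} (Φ : FCN ℂ n m) (z : EuclideanSpace ℂ (Fin n)) :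
    EuclideanSpace ℂ (Fin m) :=
  WithLp.toLp 2 (Φ.eval crelu z.ofLp)

/-- The function `ℝᵃ → ℝᵇ` computed by a real-valued network (RVNN). -/
noncomputable def rvnn {a b : ℕ} (Φ : FCN ℝ a b) (x : EuclideanSpace ℝ (Fin a)) :
    EuclideanSpace ℝ (Fin b) :=
  WithLp.toLp 2 (Φ.eval relu x.ofLp)

/-- The concatenation `(Re z, Im z) ∈ ℝ²ⁿ` of the real and imaginary parts of `z ∈ ℂⁿ`. -/
noncomputable def realParts {n : ℕ} (z : EuclideanSpace ℂ (Fin n)) :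
    EuclideanSpace ℝ (Fin (n + n)) :=
  WithLp.toLp 2 (Fin.append (fun i => (z i).re) (fun i => (z i).im))

/-- The cube `[-1,1]ⁿ + i[-1,1]ⁿ` in `ℂⁿ`. -/
def complexCube (n : ℕ) : Set (EuclideanSpace ℂ (Fin n)) :=
  {z | ∀ i, (z i).re ∈ Set.Icc (-1 : ℝ) 1 ∧ (z i).im ∈ Set.Icc (-1 : ℝ) 1}

/-- The order of the depth of a CVNN. -/
noncomputable def cvnnDepthOrder (n m : ℕ) (K ε : ℝ) : ℝ :=
  (144 * m * K ^ 2 * (n + 2) ^ 2 / ε ^ 2 + 9) ^ (2 * n)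

/-- The order of the depth of an RVNN. -/
noncomputable def rvnnDepthOrder (n m : ℕ) (K ε : ℝ) : ℝ :=
  2 * m * (2 * m * K * (1 + n / 2) / ε) ^ (4 * n)

/-! Separating real and imaginary parts turns `f` into a map `g` from the cube `[-1,1]^(2n)` to
`ℝ^(2m)` that is Lipschitz in the maximum norm with constant `κ = K √(2n)`. Each component lies
above the cones `g p - κ ‖x - p‖`, and their maximum over the centres of a grid with `N ^ (2n)`
cells is within `2 κ / N` of it.

A narrow deep network computes this maximum sequentially. Its neurons act as registers: `2n` inputs,
`2m` accumulators and one scratch register. Adding a large constant to a register before ReLU and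
subtracting it afterwards preserves its value, so a layer can change one register only
(`relu_update`). A minimum or maximum with an affine function then costs one layer. A cone in the
maximum norm is a minimum of `4n` affine functions and a constant (`update_cone`), so each centre
costs `4n + 1` layers per component.

The complex network is the same real network: `crelu` restricts to `relu` on the real axis, and only
the loading and output layers use non-real parameters. Taking `N` about `4 (K/ε) √(mn)` gives a
depth of order `gridDepth`, which both stated orders dominate up to an absolute constant. The final
comparison is one of degrees in `m`: `2n` against `4n + 1`. -/

namespace FCN

/-! ### Affine pre- and postcomposition; real networks inside complex ones -/

/-- The network evaluated after the affine substitution `y ↦ A y + v`. -/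
def precomp {𝕜 : Type} [Semiring 𝕜] {a a' b : ℕ} (A : Matrix (Fin a) (Fin a') 𝕜)
    (v : Fin a → 𝕜) : FCN 𝕜 a b → FCN 𝕜 a' b
  | output W β => output (W * A) (W.mulVec v + β)
  | hidden W β next => hidden (W * A) (W.mulVec v + β) next

/-- The network followed by the linear map `V`. -/
def postcomp {𝕜 : Type} [Semiring 𝕜] {b c : ℕ} (V : Matrix (Fin c) (Fin b) 𝕜) :
    {a : ℕ} → FCN 𝕜 a b → FCN 𝕜 a c
  | _, output W β => output (V * W) (V.mulVec β)
  | _, hidden W β next => hidden W β (next.postcomp V)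

/-- The real network with its weights read as complex numbers. -/
noncomputable def ofReal : {a b : ℕ} → FCN ℝ a b → FCN ℂ a b
  | _, _, output W β => output (W.map (↑)) (fun i => β i)
  | _, _, hidden W β next => hidden (W.map (↑)) (fun i => β i) next.ofReal

section Semiring

variable {𝕜 : Type} [Semiring 𝕜]

theorem precomp_depth {a a' b : ℕ} (A : Matrix (Fin a) (Fin a') 𝕜) (v : Fin a → 𝕜)
    (Φ : FCN 𝕜 a b) : (Φ.precomp A v).depth = Φ.depth := by
  cases Φ <;> rfl

theorem precomp_width {a b : ℕ} (A : Matrix (Fin a) (Fin a) 𝕜) (v : Fin a → 𝕜)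
    (Φ : FCN 𝕜 a b) : (Φ.precomp A v).width = Φ.width := by
  cases Φ <;> rfl

theorem precomp_eval (σ : 𝕜 → 𝕜) {a a' b : ℕ} (A : Matrix (Fin a) (Fin a') 𝕜) (v : Fin a → 𝕜)
    (Φ : FCN 𝕜 a b) (x : Fin a' → 𝕜) :
    (Φ.precomp A v).eval σ x = Φ.eval σ (A.mulVec x + v) := by
  cases Φ <;> simp [precomp, eval, Matrix.mulVec_add, add_assoc]

theorem postcomp_depth {a b c : ℕ} (V : Matrix (Fin c) (Fin b) 𝕜) (Φ : FCN 𝕜 a b) :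
    (Φ.postcomp V).depth = Φ.depth := by
  induction Φ with
  | output W β => rfl
  | hidden W β next ih => simp [postcomp, depth, ih]

theorem postcomp_width {a b c : ℕ} (V : Matrix (Fin c) (Fin b) 𝕜) (Φ : FCN 𝕜 a b) :
    (Φ.postcomp V).width ≤ max Φ.width c := by
  induction Φ with
  | output W β => simp only [postcomp, width]; omega
  | hidden W β next ih => have := ih V; simp only [postcomp, width]; omega

theorem postcomp_eval (σ : 𝕜 → 𝕜) {a b c : ℕ} (V : Matrix (Fin c) (Fin b) 𝕜) (Φ : FCN 𝕜 a b)
    (x : Fin a → 𝕜) : (Φ.postcomp V).eval σ x = V.mulVec (Φ.eval σ x) := by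
  induction Φ with
  | output W β => simp [postcomp, eval, Matrix.mulVec_add]
  | hidden W β next ih => simp [postcomp, eval, ih]

theorem le_width {𝕜 : Type} {a b : ℕ} (Φ : FCN 𝕜 a b) : a ≤ Φ.width := by
  cases Φ <;> simp [width]

end Semiring

theorem ofReal_depth {a b : ℕ} (Φ : FCN ℝ a b) : Φ.ofReal.depth = Φ.depth := by
  induction Φ with
  | output W β => rfl
  | hidden W β next ih => simp [ofReal, depth, ih]

theorem ofReal_width {a b : ℕ} (Φ : FCN ℝ a b) : Φ.ofReal.width = Φ.width := by
  induction Φ with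
  | output W β => rfl
  | hidden W β next ih => simp [ofReal, width, ih]

end FCN

theorem crelu_ofReal (x : ℝ) : crelu x = (relu x : ℝ) := by
  apply Complex.ext <;> simp [crelu, relu]

theorem Matrix.map_ofReal_mulVec {a b : ℕ} (W : Matrix (Fin b) (Fin a) ℝ) (x : Fin a → ℝ) :
    (W.map (fun r : ℝ => (r : ℂ))).mulVec (fun i => (x i : ℂ)) = fun i => ((W.mulVec x i : ℝ) : ℂ) := by
  ext i
  simp [Matrix.mulVec, dotProduct]

/-- Real weights keep real states real, and `relu 0 = 0` makes `crelu` act as `relu` on them. -/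
theorem FCN.ofReal_eval {a b : ℕ} (Φ : FCN ℝ a b) (x : Fin a → ℝ) :
    Φ.ofReal.eval crelu (fun i => (x i : ℂ)) = fun i => ((Φ.eval relu x i : ℝ) : ℂ) := by
  induction Φ with
  | output W β =>
    ext i
    simp [ofReal, eval, Matrix.map_ofReal_mulVec]
  | hidden W β next ih =>
    simp only [ofReal, eval, Matrix.map_ofReal_mulVec]
    rw [← ih]
    congr 1
    ext i
    simp [← Complex.ofReal_add, crelu_ofReal]

/-! ### Deep narrow networks as register programs -/

/-- Uniform boundedness of a family of register states. -/
def BddStates {X : Type} {w : ℕ} (S : X → Fin w → ℝ) : Prop := ∃ B : ℝ, ∀ x i, |S x i| ≤ B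

/-- The states `S'` are computed from the states `S` by `L` layers of width `w`: every network
applied to `S'` can be replaced by one applied to `S` that has `L` more layers. -/
def Simulates {X : Type} {w : ℕ} (L : ℕ) (S S' : X → Fin w → ℝ) : Prop :=
  BddStates S → BddStates S' ∧ ∀ (b : ℕ) (next : FCN ℝ w b), next.width ≤ w →
    ∃ Φ : FCN ℝ w b, Φ.width ≤ w ∧ Φ.depth = next.depth + L ∧
      ∀ x, Φ.eval relu (S x) = next.eval relu (S' x)

namespace Simulates

variable {X : Type} {w : ℕ}

theorem refl (S : X → Fin w → ℝ) : Simulates 0 S S :=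
  fun h => ⟨h, fun _ next hw => ⟨next, hw, rfl, fun _ => rfl⟩⟩

theorem trans {L L' : ℕ} {S S' S'' : X → Fin w → ℝ} (h : Simulates L S S')
    (h' : Simulates L' S' S'') : Simulates (L + L') S S'' := by
  intro hb
  obtain ⟨hb', hs⟩ := h hb
  obtain ⟨hb'', hs'⟩ := h' hb'
  refine ⟨hb'', fun b next hw => ?_⟩
  obtain ⟨Φ', hw', hd', he'⟩ := hs' b next hw
  obtain ⟨Φ, hw, hd, he⟩ := hs b Φ' hw'
  exact ⟨Φ, hw, by omega, fun x => (he x).trans (he' x)⟩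

/-- No layer is spent: the affine update is absorbed into the weights of the layer that follows. -/
theorem affine (S : X → Fin w → ℝ) (r i : Fin w) (α c k : ℝ) :
    Simulates 0 S (fun x => Function.update (S x) r (α * S x r + k * S x i + c)) := by
  rintro ⟨B, hB⟩
  refine ⟨⟨|α| * B + |k| * B + |c| + B, fun x j => ?_⟩, fun b next hw => ?_⟩
  · have hr := hB x r
    have hB0 := (abs_nonneg _).trans hr
    have h1 : |α * S x r| ≤ |α| * B := by rw [abs_mul]; gcongr
    have h2 : |k * S x i| ≤ |k| * B := by rw [abs_mul]; gcongr; exact hB x i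
    rcases eq_or_ne j r with rfl | hj
    · simp only [Function.update_self]
      have := abs_add_le (α * S x j + k * S x i) c
      have := abs_add_le (α * S x j) (k * S x i)
      linarith
    · simp only [Function.update_of_ne hj]
      have := hB x j
      have := abs_nonneg c
      nlinarith [mul_nonneg (abs_nonneg α) hB0, mul_nonneg (abs_nonneg k) hB0]
  · refine ⟨next.precomp (Matrix.updateRow 1 r (α • Pi.single r 1 + k • Pi.single i 1))
      (Pi.single r c), by rwa [FCN.precomp_width], by rw [FCN.precomp_depth, add_zero], fun x => ?_⟩
    rw [FCN.precomp_eval]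
    congr 1
    ext j
    rcases eq_or_ne j r with rfl | hj
    · simp [Matrix.mulVec, dotProduct, Pi.single_apply, add_mul, Finset.sum_add_distrib]
    · have : (Matrix.updateRow (1 : Matrix (Fin w) (Fin w) ℝ) r
          (α • Pi.single r 1 + k • Pi.single i 1)).mulVec (S x) j
          = (1 : Matrix (Fin w) (Fin w) ℝ).mulVec (S x) j := by
        simp only [Matrix.mulVec]
        congr 1
        exact Matrix.updateRow_ne hj
      simp [this, hj]

/-- The bias `B`, a bound for all states, makes every register but `r` nonnegative, so ReLU acts
there as the identity; the next layer subtracts `B` again. This is why `Simulates` carries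
boundedness along. -/
theorem relu_update (S : X → Fin w → ℝ) (r : Fin w) :
    Simulates 1 S (fun x => Function.update (S x) r (relu (S x r))) := by
  rintro ⟨B, hB⟩
  have habs : ∀ y : ℝ, |relu y| ≤ |y| := fun y => by
    rw [relu, abs_of_nonneg (le_max_right _ _)]
    exact max_le (le_abs_self y) (abs_nonneg y)
  refine ⟨⟨B, fun x j => ?_⟩, fun b next hw => ?_⟩
  · rcases eq_or_ne j r with rfl | hj
    · simp only [Function.update_self]
      exact (habs _).trans (hB x j)
    · simp only [Function.update_of_ne hj]
      exact hB x j
  · refine ⟨.hidden 1 (Function.update (fun _ => B) r 0)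
      (next.precomp 1 (-Function.update (fun _ => B) r 0)), ?_, ?_, fun x => ?_⟩
    · simp [FCN.width, FCN.precomp_width, hw]
    · simp [FCN.depth, FCN.precomp_depth]
    · rw [FCN.eval, FCN.precomp_eval]
      congr 1
      ext j
      rcases eq_or_ne j r with rfl | hj
      · simp
      · have := neg_le_of_abs_le (hB x j)
        simp only [Matrix.one_mulVec, Pi.add_apply, Pi.neg_apply, Function.update_of_ne hj, relu]
        rw [max_eq_left (by linarith)]
        ring

/-- Replacing register `r` by `ℓ + σ ReLU(σ (S r - ℓ))` with `ℓ = k S i + c` costs one layer. -/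
theorem clamp (S : X → Fin w → ℝ) {r i : Fin w} (hi : i ≠ r) (σ c k : ℝ) :
    Simulates 1 S (fun x => Function.update (S x) r
      (k * S x i + c + σ * relu (σ * (S x r - (k * S x i + c))))) := by
  -- Register `r` becomes `σ (S r - ℓ)`, passes through ReLU and is mapped back. Register `i ≠ r` is
  -- untouched, so `ℓ` is still available at the end.
  have h := ((affine S r i σ (-(σ * c)) (-(σ * k))).trans (relu_update _ r)).trans
    (affine _ r i σ c k)
  convert h using 2 with x
  simp only [Function.update_self, Function.update_of_ne hi, Function.update_idem]
  congr 1
  ring_nf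

/-- This is `min y ℓ = ℓ - ReLU(ℓ - y)`; the maximum below is `ℓ + ReLU(y - ℓ)`. -/
theorem update_min (S : X → Fin w → ℝ) {r i : Fin w} (hi : i ≠ r) (c k : ℝ) :
    Simulates 1 S (fun x => Function.update (S x) r (min (S x r) (k * S x i + c))) := by
  convert clamp S hi (-1) c k using 3 with x
  rcases le_total (S x r) (k * S x i + c) with h | h
  · rw [min_eq_left h, relu, max_eq_left (by linarith)]; ring
  · rw [min_eq_right h, relu, max_eq_right (by linarith)]; ring

theorem update_max (S : X → Fin w → ℝ) {r i : Fin w} (hi : i ≠ r) :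
    Simulates 1 S (fun x => Function.update (S x) r (max (S x r) (S x i))) := by
  convert clamp S hi 1 0 1 using 3 with x
  rcases le_total (S x r) (S x i) with h | h
  · rw [max_eq_right h, relu, max_eq_right (by linarith)]; ring
  · rw [max_eq_left h, relu, max_eq_left (by linarith)]; ring

theorem update_const (S : X → Fin w → ℝ) (r : Fin w) (c : ℝ) :
    Simulates 0 S (fun x => Function.update (S x) r c) := by
  simpa using affine S r r 0 c 0

end Simulates

/-! ### Lipschitz functions as maxima of cones -/

namespace Simulates

variable {X : Type} {w : ℕ}

/-- Taking the minimum of register `t` with finitely many affine functions of other registers. -/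
theorem exists_update_min_list (S : X → Fin w → ℝ) {t : Fin w}
    (l : List (ℝ × ℝ × Fin w)) (hl : ∀ q ∈ l, q.2.2 ≠ t) :
    ∃ v : X → ℝ, Simulates l.length S (fun x => Function.update (S x) t (v x)) ∧
      ∀ x b, b ≤ v x ↔ b ≤ S x t ∧ ∀ q ∈ l, b ≤ q.1 * S x q.2.2 + q.2.1 := by
  induction l with
  | nil => exact ⟨fun x => S x t, by simpa using refl S, by simp⟩
  | cons q l ih =>
    obtain ⟨v, hv, hb⟩ := ih fun q hq => hl q (List.mem_cons_of_mem _ hq)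
    have hq : q.2.2 ≠ t := hl q List.mem_cons_self
    refine ⟨fun x => min (v x) (q.1 * S x q.2.2 + q.2.1), ?_, fun x b => ?_⟩
    · simpa [hq] using hv.trans (update_min _ hq q.2.1 q.1)
    · simp only [le_min_iff, hb, List.forall_mem_cons]
      tauto

variable {d : ℕ}

/-- Loading a lower cone with apex `(p, c)` and slope `κ` in the maximum norm into register `t`. -/
theorem update_cone (S : X → Fin w → ℝ) {t : Fin w} {xi : Fin d → Fin w}
    (hxi : ∀ i, xi i ≠ t) (κ : ℝ≥0) (c : ℝ) (p : Fin d → ℝ) :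
    Simulates (d + d) S (fun x => Function.update (S x) t
      (c - κ * ‖(fun i => S x (xi i) - 1) - p‖)) := by
  -- The entries encode `c ± κ (x i - p i)`, where `x i = S x (xi i) - 1` undoes the shift of the
  -- stored inputs.
  let l : List (ℝ × ℝ × Fin w) :=
    (List.finRange d).map (fun i => ((κ : ℝ), c - κ * (1 + p i), xi i)) ++
      (List.finRange d).map (fun i => (-(κ : ℝ), c + κ * (1 + p i), xi i))
  obtain ⟨v, hv, hb⟩ := exists_update_min_list (fun x => Function.update (S x) t c) (t := t) l (by
    simp only [l, List.mem_append, List.mem_map]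
    rintro q (⟨i, -, rfl⟩ | ⟨i, -, rfl⟩) <;> exact hxi i)
  have hv' : Simulates (d + d) S (fun x => Function.update (S x) t (v x)) := by
    simpa [l] using (update_const S t c).trans hv
  convert hv' using 3 with x
  -- Both sides have the same lower bounds `b`: the condition `κ ‖x - p‖ ≤ c - b` in the maximum
  -- norm splits into two linear inequalities per coordinate, together with `b ≤ c`.
  refine eq_of_forall_le_iff fun b => ?_
  have hn : (κ : ℝ) * ‖(fun i => S x (xi i) - 1) - p‖
      = ‖(κ : ℝ) • ((fun i => S x (xi i) - 1) - p)‖ := by simp [norm_smul]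
  rw [hb, le_sub_comm, hn]
  simp only [l, List.forall_mem_append, List.forall_mem_map, List.mem_finRange, true_imp_iff,
    Function.update_self, Function.update_of_ne (hxi _)]
  constructor
  · intro h
    have h0 := (norm_nonneg _).trans h
    rw [pi_norm_le_iff_of_nonneg h0] at h
    refine ⟨by linarith, fun i => ?_, fun i => ?_⟩ <;> have := abs_le.1 (h i) <;>
      simp only [Pi.smul_apply, Pi.sub_apply, smul_eq_mul] at this <;> linarith
  · rintro ⟨h0, h1, h2⟩
    rw [pi_norm_le_iff_of_nonneg (by linarith)]
    intro i
    rw [Real.norm_eq_abs, abs_le]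
    simp only [Pi.smul_apply, Pi.sub_apply, smul_eq_mul]
    constructor <;> linarith [h1 i, h2 i]

/-- Accumulating in register `r` the maximum of finitely many lower cones below a Lipschitz
function `g`. -/
theorem exists_max_cones {D : Set (Fin d → ℝ)} (S : D → Fin w → ℝ) {t r : Fin w}
    {xi : Fin d → Fin w} (hxi : ∀ i, xi i ≠ t) (hxr : ∀ i, xi i ≠ r) (hrt : t ≠ r)
    (hS : ∀ x i, S x (xi i) = x.1 i + 1) {κ : ℝ≥0} {g : (Fin d → ℝ) → ℝ}
    (hg : LipschitzOnWith κ g D) (l : List (Fin d → ℝ)) (hl : ∀ p ∈ l, p ∈ D) :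
    ∃ S' : D → Fin w → ℝ, Simulates (l.length * (d + d + 1)) S S' ∧
      (∀ x i, i ≠ t → i ≠ r → S' x i = S x i) ∧ ∀ x, S x r ≤ g x →
        S' x r ≤ g x ∧ S x r ≤ S' x r ∧ ∀ p ∈ l, g p - κ * ‖x.1 - p‖ ≤ S' x r := by
  induction l with
  | nil => exact ⟨S, by simpa using refl S, by simp, by simp⟩
  | cons p l ih =>
    obtain ⟨S', hs, he, hm⟩ := ih fun q hq => hl q (List.mem_cons_of_mem _ hq)
    have hx : ∀ x : D, (fun i => S' x (xi i) - 1) = x.1 := fun x => by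
      ext i; rw [he x _ (hxi i) (hxr i), hS]; ring
    have step := hs.trans ((update_cone S' hxi κ (g p) p).trans (update_max _ hrt))
    rw [show l.length * (d + d + 1) + (d + d + 1) = (p :: l).length * (d + d + 1) by
      rw [List.length_cons]; ring] at step
    refine ⟨_, step, ?_, ?_⟩
    · intro x i hi hi'
      simp [hi, hi', he]
    · intro x hle
      obtain ⟨h1, h2, h3⟩ := hm x hle
      have hp : g p - κ * ‖x.1 - p‖ ≤ g x := by
        have := hg.dist_le_mul p (hl p List.mem_cons_self) x x.2
        rw [Real.dist_eq, dist_comm p, dist_eq_norm] at this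
        linarith [le_abs_self (g p - g x)]
      simp only [Function.update_self, Function.update_of_ne hrt.symm, hx, List.forall_mem_cons]
      exact ⟨max_le h1 hp, le_max_of_le_left h2, le_max_right _ _,
        fun q hq => le_max_of_le_left (h3 q hq)⟩

/-- Loading approximations of the components `g · j` of a Lipschitz map into the registers
`acc j`. -/
theorem exists_approx_list {D : Set (Fin d → ℝ)} {k : ℕ} (S : D → Fin w → ℝ) {t : Fin w}
    {xi : Fin d → Fin w} {acc : Fin k → Fin w} (hxi : ∀ i, xi i ≠ t)
    (hxr : ∀ i j, xi i ≠ acc j) (hrt : ∀ j, t ≠ acc j) (hacc : Function.Injective acc)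
    (hS : ∀ x i, S x (xi i) = x.1 i + 1) {κ : ℝ≥0} {g : (Fin d → ℝ) → Fin k → ℝ}
    (hg : LipschitzOnWith κ g D) (hbdd : ∀ j, ∃ b, ∀ x ∈ D, b ≤ g x j) (l : List (Fin d → ℝ))
    (hl : ∀ p ∈ l, p ∈ D) {δ : ℝ} (hδ : ∀ x ∈ D, ∃ p ∈ l, ‖x - p‖ ≤ δ) (js : List (Fin k)) :
    ∃ S' : D → Fin w → ℝ, Simulates (js.length * (l.length * (d + d + 1))) S S' ∧
      (∀ x i, S' x (xi i) = x.1 i + 1) ∧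
        ∀ x, ∀ j ∈ js, |S' x (acc j) - g x j| ≤ 2 * κ * δ := by
  induction js with
  | nil => exact ⟨S, by simpa using refl S, hS, by simp⟩
  | cons j js ih =>
    obtain ⟨S', hs, he, hm⟩ := ih
    obtain ⟨b, hb⟩ := hbdd j
    have hgj : ∀ j, LipschitzOnWith κ (fun x => g x j) D := fun j =>
      LipschitzOnWith.of_dist_le_mul fun x hx y hy =>
        (dist_le_pi_dist _ _ j).trans (hg.dist_le_mul x hx y hy)
    -- The accumulator starts from a lower bound `b` of the component, so that the running maximum
    -- never exceeds `g`.
    obtain ⟨S'', hs', he', hm'⟩ := exists_max_cones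
      (fun x => Function.update (S' x) (acc j) b) hxi (hxr · j) (hrt j)
      (fun x i => by rw [Function.update_of_ne (hxr i j), he]) (hgj j) l hl
    refine ⟨S'', ?_, fun x i => ?_, fun x j' hj' => ?_⟩
    · rw [List.length_cons, add_mul, one_mul]
      simpa using (hs.trans (update_const S' (acc j) b)).trans hs'
    · rw [he' x _ (hxi i) (hxr i j), Function.update_of_ne (hxr i j), he]
    · rcases eq_or_ne j' j with rfl | hne
      -- With `p` within `δ` of `x`, the accumulator is at least `g p - κ δ ≥ g x - 2 κ δ`, and it
      -- is at most `g x`.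
      · obtain ⟨h1, -, h3⟩ := hm' x (by simpa using hb x x.2)
        obtain ⟨p, hp, hd⟩ := hδ x x.2
        have h4 := (hgj j').dist_le_mul x x.2 p (hl p hp)
        rw [dist_eq_norm x.1, Real.dist_eq] at h4
        have h5 : (κ : ℝ) * ‖x.1 - p‖ ≤ κ * δ := by gcongr
        have h6 := le_abs_self (g x j' - g p j')
        rw [abs_le]
        constructor <;> linarith [h3 p hp, (mul_nonneg κ.2 (norm_nonneg (x.1 - p)))]
      · rw [he' x _ (hrt j').symm (hacc.ne hne), Function.update_of_ne (hacc.ne hne)]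
        exact hm x j' ((List.mem_cons.1 hj').resolve_left hne)

end Simulates

/-! ### The uniform grid and the resulting approximation -/

/-- The centres of the cells of the uniform grid with `N ^ d` cells on `[-1, 1] ^ d`. -/
noncomputable def gridCenters (d N : ℕ) : List (Fin d → ℝ) :=
  (Finset.univ : Finset (Fin d → Fin N)).toList.map fun k i => (2 * (k i : ℕ) + 1) / N - 1

theorem length_gridCenters (d N : ℕ) : (gridCenters d N).length = N ^ d := by
  simp [gridCenters]

theorem mem_closedBall_of_mem_gridCenters {d N : ℕ} {p : Fin d → ℝ} (hp : p ∈ gridCenters d N) :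
    p ∈ Metric.closedBall (0 : Fin d → ℝ) 1 := by
  simp only [gridCenters, List.mem_map] at hp
  obtain ⟨k, -, rfl⟩ := hp
  rw [mem_closedBall_zero_iff, pi_norm_le_iff_of_nonneg zero_le_one]
  intro i
  have hk : ((k i : ℕ) : ℝ) + 1 ≤ N := by exact_mod_cast (k i).2
  have hN : (0 : ℝ) < N := by linarith [(Nat.cast_nonneg (k i : ℕ) : (0 : ℝ) ≤ _)]
  have h1 : (2 * ((k i : ℕ) : ℝ) + 1) / N ≤ 2 := by rw [div_le_iff₀ hN]; linarith
  have h2 : 0 ≤ (2 * ((k i : ℕ) : ℝ) + 1) / N := by positivity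
  rw [Real.norm_eq_abs, abs_le]
  constructor <;> linarith

theorem exists_gridCenters_near {d N : ℕ} (hN : 1 ≤ N) {x : Fin d → ℝ}
    (hx : x ∈ Metric.closedBall (0 : Fin d → ℝ) 1) :
    ∃ p ∈ gridCenters d N, ‖x - p‖ ≤ 1 / N := by
  rw [mem_closedBall_zero_iff, pi_norm_le_iff_of_nonneg zero_le_one] at hx
  have hN' : (0 : ℝ) < N := by exact_mod_cast hN
  have key : ∀ u : ℝ, |u| ≤ 1 → ∃ k : Fin N, |u - ((2 * (k : ℕ) + 1) / N - 1)| ≤ 1 / N := by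
    intro u hu
    obtain ⟨h1, h2⟩ := abs_le.1 hu
    have e : ∀ k : ℝ, u - ((2 * k + 1) / N - 1) = ((u + 1) * N - (2 * k + 1)) / N := fun k => by
      field_simp; ring
    have hu0 : 0 ≤ (u + 1) * N / 2 := by have : 0 ≤ u + 1 := by linarith
                                         positivity
    -- The floor is the index of the cell containing `u`, except at the endpoint `u = 1`, where it
    -- equals `N` and the last cell serves.
    rcases lt_or_ge ⌊(u + 1) * N / 2⌋₊ N with h | h
    · refine ⟨⟨_, h⟩, ?_⟩
      rw [e, abs_div, abs_of_pos hN', div_le_div_iff_of_pos_right hN', abs_le]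
      have := Nat.floor_le hu0
      have := Nat.lt_floor_add_one ((u + 1) * N / 2)
      constructor <;> dsimp only <;> linarith
    · refine ⟨⟨N - 1, by omega⟩, ?_⟩
      rw [e, abs_div, abs_of_pos hN', div_le_div_iff_of_pos_right hN', abs_le]
      have h3 : (N : ℝ) ≤ (u + 1) * N / 2 := (Nat.cast_le.2 h).trans (Nat.floor_le hu0)
      have h4 : (u + 1) * N ≤ 2 * N := by gcongr; linarith
      push_cast [Nat.cast_sub hN]
      constructor <;> linarith
  choose k hk using fun i => key (x i) (hx i)
  refine ⟨_, List.mem_map.2 ⟨k, by simp, rfl⟩, ?_⟩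
  rw [pi_norm_le_iff_of_nonneg (by positivity)]
  exact hk

/-- A network on registers preloaded with the shifted inputs `x i + 1` which approximates a
Lipschitz map on `[-1, 1] ^ d`. -/
theorem FCN.exists_approx_of_registers {d k w : ℕ}
    (S : Metric.closedBall (0 : Fin d → ℝ) 1 → Fin w → ℝ) (hSb : BddStates S) {t : Fin w}
    {xi : Fin d → Fin w} {acc : Fin k → Fin w} (hxi : ∀ i, xi i ≠ t)
    (hxr : ∀ i j, xi i ≠ acc j) (hrt : ∀ j, t ≠ acc j) (hacc : Function.Injective acc)
    (hS : ∀ x i, S x (xi i) = x.1 i + 1) {κ : ℝ≥0} {g : (Fin d → ℝ) → Fin k → ℝ}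
    (hg : LipschitzOnWith κ g (Metric.closedBall 0 1)) {N : ℕ} (hN : 1 ≤ N) :
    ∃ Ψ : FCN ℝ w k, Ψ.width ≤ w ∧ Ψ.depth = 1 + k * (N ^ d * (d + d + 1)) ∧
      ∀ x j, |Ψ.eval relu (S x) j - g x j| ≤ 2 * κ / N := by
  obtain ⟨S', hs, -, hm⟩ := Simulates.exists_approx_list S hxi hxr hrt hacc hS hg
    (fun j => ⟨g 0 j - κ, fun x hx => by
      have h := (dist_le_pi_dist _ _ j).trans (hg.dist_le_mul x hx 0 (by simp))
      have hx' : dist x 0 ≤ 1 := hx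
      have : (κ : ℝ) * dist x 0 ≤ κ * 1 := by gcongr
      rw [Real.dist_eq] at h
      linarith [neg_abs_le (g x j - g 0 j)]⟩)
    (gridCenters d N) (fun p => mem_closedBall_of_mem_gridCenters)
    (fun x hx => exists_gridCenters_near hN hx) (List.finRange k)
  obtain ⟨-, hs⟩ := hs hSb
  obtain ⟨Ψ, hw, hd, he⟩ := hs k
    (.output (Matrix.of fun j => Pi.single (acc j) 1) 0) (by
      simpa [FCN.width] using Fintype.card_le_of_injective acc hacc)
  refine ⟨Ψ, hw, by simpa [length_gridCenters, FCN.depth] using hd, fun x j => ?_⟩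
  have := hm x j (by simp)
  rw [he]
  simpa [FCN.eval, Matrix.mulVec, div_eq_mul_inv] using this

/-! ### Passage between `ℂⁿ` and `ℝ²ⁿ`, Euclidean and maximum norms -/

theorem EuclideanSpace.norm_le_sqrt_mul {k : ℕ} {v : EuclideanSpace ℝ (Fin k)} {c : ℝ}
    (hc : 0 ≤ c) (hv : ∀ i, |v i| ≤ c) : ‖v‖ ≤ √k * c := by
  rw [EuclideanSpace.norm_eq, ← Real.sqrt_sq hc, ← Real.sqrt_mul (Nat.cast_nonneg k)]
  apply Real.sqrt_le_sqrt
  calc ∑ i, ‖v i‖ ^ 2 ≤ ∑ _i : Fin k, c ^ 2 := by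
        gcongr with i
        exact hv i
    _ = k * c ^ 2 := by simp

theorem norm_realParts {n : ℕ} (z : EuclideanSpace ℂ (Fin n)) : ‖realParts z‖ = ‖z‖ := by
  rw [EuclideanSpace.norm_eq, EuclideanSpace.norm_eq, Fin.sum_univ_add, ← Finset.sum_add_distrib]
  congr 1
  refine Finset.sum_congr rfl fun i _ => ?_
  rw [Complex.sq_norm, Complex.normSq_apply]
  simp [realParts, -Fin.natAdd_eq_addNat]
  ring

theorem realParts_sub {n : ℕ} (z w : EuclideanSpace ℂ (Fin n)) :
    realParts (z - w) = realParts z - realParts w := by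
  ext i
  refine Fin.addCases (fun i => ?_) (fun i => ?_) i <;> simp [realParts, -Fin.natAdd_eq_addNat]

/-- The complex vector with given real and imaginary parts. -/
noncomputable def ofRealParts {n : ℕ} (x : Fin (n + n) → ℝ) : EuclideanSpace ℂ (Fin n) :=
  WithLp.toLp 2 fun i => ⟨x (Fin.castAdd n i), x (Fin.natAdd n i)⟩

theorem realParts_ofRealParts {n : ℕ} (x : Fin (n + n) → ℝ) :
    realParts (ofRealParts x) = WithLp.toLp 2 x := by
  ext i
  refine Fin.addCases (fun i => ?_) (fun i => ?_) i <;> simp [realParts, ofRealParts, -Fin.natAdd_eq_addNat]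

theorem ofRealParts_realParts {n : ℕ} (z : EuclideanSpace ℂ (Fin n)) :
    ofRealParts (realParts z).ofLp = z := by
  ext i
  simp [realParts, ofRealParts, -Fin.natAdd_eq_addNat]

theorem realParts_mem_closedBall {n : ℕ} {z : EuclideanSpace ℂ (Fin n)} (hz : z ∈ complexCube n) :
    (realParts z).ofLp ∈ Metric.closedBall (0 : Fin (n + n) → ℝ) 1 := by
  rw [mem_closedBall_zero_iff, pi_norm_le_iff_of_nonneg zero_le_one]
  intro i
  refine Fin.addCases (fun i => ?_) (fun i => ?_) i <;>
    simpa [realParts, Real.norm_eq_abs, abs_le, -Fin.natAdd_eq_addNat] using by first | exact (hz i).1 | exact (hz i).2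

theorem ofRealParts_mem_complexCube {n : ℕ} {x : Fin (n + n) → ℝ}
    (hx : x ∈ Metric.closedBall (0 : Fin (n + n) → ℝ) 1) : ofRealParts x ∈ complexCube n := by
  rw [mem_closedBall_zero_iff, pi_norm_le_iff_of_nonneg zero_le_one] at hx
  exact fun i => ⟨abs_le.1 (hx (Fin.castAdd n i)), abs_le.1 (hx (Fin.natAdd n i))⟩

/-- The factor `√(2n)` comes from bounding the Euclidean norm by the maximum norm on the domain; on
the codomain the change of norm goes the free way. -/
theorem LipschitzOnWith.realParts_comp {n m : ℕ} {K : ℝ≥0}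
    {f : EuclideanSpace ℂ (Fin n) → EuclideanSpace ℂ (Fin m)}
    (hf : LipschitzOnWith K f (complexCube n)) :
    LipschitzOnWith (K * NNReal.sqrt (n + n : ℕ)) (fun x => (realParts (f (ofRealParts x))).ofLp)
      (Metric.closedBall 0 1) := by
  refine LipschitzOnWith.of_dist_le_mul fun x hx y hy => ?_
  have h1 := hf.dist_le_mul _ (ofRealParts_mem_complexCube hx) _ (ofRealParts_mem_complexCube hy)
  have h2 : dist (ofRealParts x) (ofRealParts y) ≤ √(n + n : ℕ) * dist x y := by
    rw [dist_eq_norm, ← norm_realParts, realParts_sub, realParts_ofRealParts,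
      realParts_ofRealParts]
    exact EuclideanSpace.norm_le_sqrt_mul dist_nonneg fun i => dist_le_pi_dist x y i
  calc _ ≤ dist (f (ofRealParts x)) (f (ofRealParts y)) := by
        rw [dist_eq_norm (f _), ← norm_realParts, realParts_sub]
        exact (dist_pi_le_iff (norm_nonneg _)).2 fun i => PiLp.norm_apply_le
          (realParts (f (ofRealParts x)) - realParts (f (ofRealParts y))) i
    _ ≤ K * (√(n + n : ℕ) * dist x y) := h1.trans (by gcongr)
    _ = _ := by push_cast; ring

/-! ### The loading layer -/

/-- The registers preloaded with the shifted inputs `x i + 1`. -/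
noncomputable def loaded (w : ℕ) {d : ℕ} (x : Fin d → ℝ) (r : Fin w) : ℝ :=
  1 + if h : r.val < d then x ⟨r, h⟩ else 0

/-- Nonnegativity is the purpose of the shift by `1`: the activation of the loading layer leaves the
inputs intact. The upper bound makes the initial states bounded. -/
theorem loaded_mem_Icc {w d : ℕ} {x : Fin d → ℝ}
    (hx : x ∈ Metric.closedBall (0 : Fin d → ℝ) 1) (r : Fin w) : loaded w x r ∈ Set.Icc 0 2 := by
  rw [mem_closedBall_zero_iff, pi_norm_le_iff_of_nonneg zero_le_one] at hx
  unfold loaded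
  split_ifs with h
  · have := abs_le.1 (hx ⟨r, h⟩)
    constructor <;> linarith
  · norm_num

theorem relu_eq_loaded {w d : ℕ} {x : Fin d → ℝ}
    (hx : x ∈ Metric.closedBall (0 : Fin d → ℝ) 1) (r : Fin w) :
    relu (((Matrix.of fun (r : Fin w) (i : Fin d) => if r.val = i.val then (1 : ℝ) else 0).mulVec x
      + 1) r) = loaded w x r := by
  have e : ((Matrix.of fun (r : Fin w) (i : Fin d) => if r.val = i.val then (1 : ℝ) else 0).mulVec x
      + 1) r = loaded w x r := by
    rw [loaded, Pi.add_apply, add_comm, Pi.one_apply, Matrix.mulVec, dotProduct]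
    congr 1
    split_ifs with h
    · rw [Finset.sum_eq_single ⟨r, h⟩]
      · simp
      · intro i _ hi
        have : r.val ≠ i.val := fun e => hi (Fin.ext e.symm)
        simp [this]
      · simp
    · refine Finset.sum_eq_zero fun i _ => ?_
      have : r.val ≠ i.val := by omega
      simp [this]
  rw [e, relu, max_eq_left (loaded_mem_Icc hx r).1]

/-- The rows produce `z i` and `-I * z i`, whose real parts are `Re (z i)` and `Im (z i)`. The bias
`1 - 2i` makes the real part nonnegative and the imaginary part negative, so `crelu` keeps the
former and erases the latter. -/
theorem crelu_eq_loaded {w n : ℕ} {z : EuclideanSpace ℂ (Fin n)} (hz : z ∈ complexCube n)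
    (r : Fin w) :
    crelu (((Matrix.of fun (r : Fin w) (i : Fin n) => if r.val = i.val then (1 : ℂ) else
      if r.val = n + i.val then -Complex.I else 0).mulVec z.ofLp + fun _ => Complex.mk 1 (-2) : Fin w → ℂ) r)
      = (loaded w (realParts z).ofLp r : ℝ) := by
  rw [Pi.add_apply, Matrix.mulVec, dotProduct]
  rcases lt_or_ge r.val n with h | h
  · rw [Finset.sum_eq_single ⟨r, h⟩]
    · have hl : loaded w (realParts z).ofLp r = 1 + (z ⟨r, h⟩).re := by
        rw [loaded, dif_pos (by omega)]
        congr 1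
        exact Fin.append_left (fun i => (z i).re) (fun i => (z i).im) (⟨r, h⟩ : Fin n)
      obtain ⟨⟨h1, h2⟩, h3, h4⟩ := hz ⟨r, h⟩
      rw [hl]
      apply Complex.ext
      · simp only [crelu, relu, Matrix.of_apply, if_true, one_mul, Complex.add_re,
          Complex.ofReal_re]
        rw [max_eq_left (by linarith), add_comm]
      · simp only [crelu, relu, Matrix.of_apply, if_true, one_mul, Complex.add_im,
          Complex.ofReal_im]
        exact max_eq_right (by linarith)
    · intro i _ hi
      have h1 : r.val ≠ i.val := fun e => hi (Fin.ext e.symm)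
      have h2 : r.val ≠ n + i.val := by omega
      simp [h1, h2]
    · simp
  rcases lt_or_ge r.val (n + n) with h' | h'
  · have hlt : r.val - n < n := by omega
    rw [Finset.sum_eq_single ⟨r.val - n, hlt⟩]
    · have hl : loaded w (realParts z).ofLp r = 1 + (z ⟨r.val - n, hlt⟩).im := by
        rw [loaded, dif_pos h']
        congr 1
        have : (⟨r, h'⟩ : Fin (n + n)) = Fin.natAdd n ⟨r.val - n, hlt⟩ := by
          ext; simp; omega
        rw [this]
        exact Fin.append_right (fun i => (z i).re) (fun i => (z i).im) ⟨r.val - n, hlt⟩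
      obtain ⟨⟨h1, h2⟩, h3, h4⟩ := hz ⟨r.val - n, hlt⟩
      have e1 : r.val ≠ r.val - n := by omega
      have e2 : r.val = n + (r.val - n) := by omega
      rw [hl]
      simp only [Matrix.of_apply, if_neg e1, if_pos e2]
      apply Complex.ext
      · simp only [crelu, relu, Complex.add_re, Complex.ofReal_re, neg_mul, Complex.neg_re,
          Complex.I_mul_re, neg_neg]
        rw [max_eq_left (by linarith), add_comm]
      · simp only [crelu, relu, Complex.add_im, Complex.ofReal_im, neg_mul, Complex.neg_im,
          Complex.I_mul_im]
        exact max_eq_right (by linarith)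
    · intro i _ hi
      have h1 : r.val ≠ i.val := by omega
      have h2 : r.val ≠ n + i.val := fun e => hi (Fin.ext (by simp; omega))
      simp [h1, h2]
    · simp
  · rw [Finset.sum_eq_zero, loaded, dif_neg (by omega)]
    · apply Complex.ext <;> simp [crelu, relu]
    · intro i _
      have h1 : r.val ≠ i.val := by omega
      have h2 : r.val ≠ n + i.val := by omega
      simp [h1, h2]

theorem FCN.exists_approx_loaded {d k w : ℕ} (hw : d + k + 1 ≤ w) {κ : ℝ≥0}
    {g : (Fin d → ℝ) → Fin k → ℝ} (hg : LipschitzOnWith κ g (Metric.closedBall 0 1)) {N : ℕ}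
    (hN : 1 ≤ N) :
    ∃ Ψ : FCN ℝ w k, Ψ.width ≤ w ∧ Ψ.depth = 1 + k * (N ^ d * (d + d + 1)) ∧
      ∀ x ∈ Metric.closedBall (0 : Fin d → ℝ) 1, ∀ j,
        |Ψ.eval relu (loaded w x) j - g x j| ≤ 2 * κ / N := by
  have hb : BddStates fun x : Metric.closedBall (0 : Fin d → ℝ) 1 => loaded w x.1 :=
    ⟨2, fun x r => by
      have := loaded_mem_Icc x.2 r
      exact abs_le.2 ⟨by linarith [this.1], this.2⟩⟩
  obtain ⟨Ψ, h1, h2, h3⟩ := exists_approx_of_registers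
    (fun x : Metric.closedBall (0 : Fin d → ℝ) 1 => loaded w x.1) hb (t := ⟨d + k, by omega⟩)
    (xi := fun i => ⟨i, by omega⟩) (acc := fun j => ⟨d + j, by omega⟩)
    (fun i => by simp only [ne_eq, Fin.mk.injEq]; omega)
    (fun i j => by simp only [ne_eq, Fin.mk.injEq]; omega)
    (fun j => by simp only [ne_eq, Fin.mk.injEq]; omega)
    (fun i j h => by simp only [Fin.mk.injEq] at h; ext; omega)
    (fun x i => by simp [loaded, add_comm]) hg hN
  exact ⟨Ψ, h1, h2, fun x hx => h3 ⟨x, hx⟩⟩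

/-! ### Comparison of the depth bounds -/

/-- This makes the final constant independent of `n`: `4n + 1 ≤ 5 * 2 ^ n`, and `144 ^ n / n ^ n ≤
144 ^ n / n!` is bounded by the exponential series at `144`. -/
theorem pow_div_le_exp (n : ℕ) (hn : 1 ≤ n) :
    (4 * n + 1 : ℝ) * (72 / n) ^ n ≤ 5 * Real.exp 144 := by
  have hn0 : (0 : ℝ) < n := by exact_mod_cast hn
  have h1 : (n : ℝ) ≤ 2 ^ n := by exact_mod_cast Nat.lt_two_pow_self.le
  have h2 : (1 : ℝ) ≤ 2 ^ n := one_le_pow₀ one_le_two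
  have h3 : ((n.factorial : ℕ) : ℝ) ≤ (n : ℝ) ^ n := by exact_mod_cast Nat.factorial_le_pow n
  have h4 := Real.pow_div_factorial_le_exp 144 (by norm_num) n
  calc (4 * n + 1 : ℝ) * (72 / n) ^ n ≤ (5 * 2 ^ n) * (72 / n) ^ n := by gcongr; linarith
    _ = 5 * (144 ^ n / (n : ℝ) ^ n) := by
        rw [show (144 : ℝ) = 2 * 72 by norm_num, mul_pow, div_pow]; ring
    _ ≤ 5 * (144 ^ n / (n.factorial : ℝ)) := by gcongr
    _ ≤ _ := by gcongr

/-- The number of layers used to evaluate the grid approximation in terms of `a = K / ε`. -/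
noncomputable def gridDepth (n m : ℕ) (a : ℝ) : ℝ :=
  2 * m * (4 * n + 1) * (36 * a ^ 2 * m * n) ^ n

/-- The base of `gridDepth` is quadratic in `a`, the target quartic. The hypothesis `h`, valid
whenever a constant network does not suffice, supplies the missing factor `a ^ 2`; the remaining `72
/ n` is left for `pow_div_le_exp`. -/
theorem gridDepth_le_real {n m : ℕ} (hn : 1 ≤ n) (hm : 1 ≤ m) {a : ℝ} (ha : 0 < a)
    (h : 1 ≤ 2 * n * a ^ 2) :
    gridDepth n m a ≤ 5 * Real.exp 144 * (2 * m * (2 * m * a * (1 + n / 2)) ^ (4 * n)) := by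
  have hn0 : (1 : ℝ) ≤ n := by exact_mod_cast hn
  have hm0 : (1 : ℝ) ≤ m := by exact_mod_cast hm
  have key : 36 * a ^ 2 * m * n ≤ (72 / n) * (2 * m * a * (1 + n / 2)) ^ 4 := by
    calc 36 * a ^ 2 * m * n ≤ 36 * a ^ 2 * m ^ 4 * n ^ 2 := by
          gcongr
          · exact le_self_pow₀ hm0 (by norm_num)
          · exact le_self_pow₀ hn0 (by norm_num)
      _ ≤ (36 * a ^ 2 * m ^ 4 * n ^ 2) * (2 * n * a ^ 2) :=
          le_mul_of_one_le_right (by positivity) h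
      _ = (72 / n) * (m * a * n) ^ 4 := by field_simp; norm_num
      _ ≤ _ := by
          have : m * a * n ≤ 2 * m * a * (1 + n / 2) := by
            nlinarith [mul_pos (by linarith : (0 : ℝ) < m) ha]
          gcongr (72 / (n : ℝ)) * ?_ ^ 4
  calc gridDepth n m a
      ≤ 2 * m * (4 * n + 1) * ((72 / n) * (2 * m * a * (1 + n / 2)) ^ 4) ^ n := by
        unfold gridDepth; gcongr
    _ = ((4 * n + 1 : ℝ) * (72 / n) ^ n) * (2 * m * (2 * m * a * (1 + n / 2)) ^ (4 * n)) := by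
        rw [mul_pow, pow_mul]; ring
    _ ≤ _ := mul_le_mul_of_nonneg_right (pow_div_le_exp n hn) (by positivity)

theorem gridDepth_le_complex {n m : ℕ} (hn : 1 ≤ n) (hm : 1 ≤ m) {a : ℝ}
    (h : 1 ≤ 2 * n * a ^ 2) :
    gridDepth n m a ≤ 5 * Real.exp 144 * (144 * m * a ^ 2 * (n + 2) ^ 2 + 9) ^ (2 * n) := by
  have hn0 : (1 : ℝ) ≤ n := by exact_mod_cast hn
  have hm0 : (1 : ℝ) ≤ m := by exact_mod_cast hm
  have key : 72 * a ^ 2 * m ^ 2 * n ≤ (72 / n) * (144 * m * a ^ 2 * (n + 2) ^ 2 + 9) ^ 2 := by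
    calc 72 * a ^ 2 * m ^ 2 * n ≤ (72 * a ^ 2 * m ^ 2 * n) * (2 * n * a ^ 2) :=
          le_mul_of_one_le_right (by positivity) h
      _ = (72 / n) * ((2 * n) * (m ^ 2 * (a ^ 2) ^ 2 * n ^ 2)) := by field_simp
      _ ≤ (72 / n) * ((144 ^ 2 * n ^ 2) * (m ^ 2 * (a ^ 2) ^ 2 * n ^ 2)) := by
          gcongr <;> nlinarith
      _ = (72 / n) * (144 * m * a ^ 2 * n ^ 2 + 0) ^ 2 := by ring
      _ ≤ _ := by gcongr <;> linarith
  -- The target has no prefactor `2m`, so this factor moves into the `n`-th power.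
  have h2 : (2 * m : ℝ) ≤ (2 * m) ^ n := le_self_pow₀ (by linarith) (by omega)
  calc gridDepth n m a
      ≤ (2 * m) ^ n * (4 * n + 1) * (36 * a ^ 2 * m * n) ^ n := by
        unfold gridDepth; gcongr
    _ = (4 * n + 1) * (72 * a ^ 2 * m ^ 2 * n) ^ n := by
        rw [mul_right_comm, ← mul_pow]; ring_nf
    _ ≤ (4 * n + 1) * ((72 / n) * (144 * m * a ^ 2 * (n + 2) ^ 2 + 9) ^ 2) ^ n := by gcongr
    _ = ((4 * n + 1 : ℝ) * (72 / n) ^ n) * (144 * m * a ^ 2 * (n + 2) ^ 2 + 9) ^ (2 * n) := by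
        rw [mul_pow, pow_mul]; ring
    _ ≤ _ := mul_le_mul_of_nonneg_right (pow_div_le_exp n hn) (by positivity)

theorem cvnnDepthOrder_lt_rvnnDepthOrder {n : ℕ} (hn : 1 ≤ n) {K ε c : ℝ} (hK : 0 < K)
    (hε : 0 < ε) (hc : 0 < c) :
    ∃ M : ℕ, ∀ m : ℕ, M ≤ m → cvnnDepthOrder n m K ε < c * rvnnDepthOrder n m K ε := by
  set α : ℝ := 144 * K ^ 2 * (n + 2) ^ 2 / ε ^ 2 with hα
  set β : ℝ := 2 * K * (1 + n / 2) / ε with hβ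
  have hβ0 : 0 < β := by positivity
  have hα0 : 0 < α := by positivity
  -- Beyond these thresholds `α m + 9 ≤ (α + 9) m ≤ (β m) ^ 2`, and the prefactor satisfies `2 c m >
  -- 1`, which gives strictness.
  obtain ⟨M, hM⟩ := exists_nat_gt (max ((α + 9) / β ^ 2) (max (1 / (2 * c)) 1))
  refine ⟨M, fun m hm => ?_⟩
  have hm' := hM.trans_le (Nat.cast_le.2 hm : (M : ℝ) ≤ m)
  obtain ⟨h1, h2, h3⟩ : (α + 9) / β ^ 2 < m ∧ 1 / (2 * c) < m ∧ (1 : ℝ) < m := by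
    simpa only [max_lt_iff] using hm'
  rw [div_lt_iff₀ (by positivity)] at h1 h2
  have e1 : cvnnDepthOrder n m K ε = (α * m + 9) ^ (2 * n) := by
    rw [cvnnDepthOrder, hα]; congr 1; ring
  have e2 : rvnnDepthOrder n m K ε = 2 * m * ((β * m) ^ 2) ^ (2 * n) := by
    rw [rvnnDepthOrder, hβ, ← pow_mul]; ring_nf
  rw [e1, e2]
  calc (α * m + 9) ^ (2 * n) ≤ ((β * m) ^ 2) ^ (2 * n) := by
        gcongr
        nlinarith
    _ = 1 * ((β * m) ^ 2) ^ (2 * n) := (one_mul _).symm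
    _ < (c * (2 * m)) * ((β * m) ^ 2) ^ (2 * n) := by
        gcongr
        linarith
    _ = _ := by ring

/-! ### Choice of the grid and assembly of the networks -/

/-- A real network on preloaded registers that approximates a Lipschitz map on the cube. -/
theorem LipschitzOnWith.exists_net {n m w : ℕ} (hm0 : 1 ≤ m) (hw : n + n + (m + m) + 1 ≤ w) {K : ℝ≥0}
    {f : EuclideanSpace ℂ (Fin n) → EuclideanSpace ℂ (Fin m)}
    (hf : LipschitzOnWith K f (complexCube n)) {ε : ℝ} (hε : 0 < ε) :
    ∃ Ψ : FCN ℝ w (m + m), Ψ.width ≤ w ∧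
      (Ψ.depth = 1 ∨ 1 ≤ 2 * n * (K / ε) ^ 2 ∧ (Ψ.depth : ℝ) ≤ 1 + gridDepth n m (K / ε)) ∧
      ∀ z ∈ complexCube n,
        ‖realParts (f z) - WithLp.toLp 2 (Ψ.eval relu (loaded w (realParts z).ofLp))‖ ≤ ε := by
  have hg := hf.realParts_comp
  set κ : ℝ≥0 := K * NNReal.sqrt (n + n : ℕ) with hκ
  have hκ' : (κ : ℝ) = K * √(2 * n) := by
    rw [hκ]; push_cast; rw [two_mul]
  -- The cube has Euclidean radius `√(2n)`, so for `κ ≤ ε` the constant `f 0` is good enough.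
  -- Otherwise `a √(2n) > 1`, which the depth comparisons and the rounding of `N` require.
  by_cases hc : (κ : ℝ) ≤ ε
  · refine ⟨.output 0 (realParts (f 0)).ofLp, by simp only [FCN.width]; omega, Or.inl rfl,
      fun z hz => ?_⟩
    have h0 : (0 : EuclideanSpace ℂ (Fin n)) ∈ complexCube n := fun i => by simp
    have h1 := hf.dist_le_mul z hz 0 h0
    have h2 : ‖z‖ ≤ √(n + n : ℕ) * 1 := by
      rw [← norm_realParts]
      have := realParts_mem_closedBall hz
      rw [mem_closedBall_zero_iff, pi_norm_le_iff_of_nonneg zero_le_one] at this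
      exact EuclideanSpace.norm_le_sqrt_mul zero_le_one this
    have e : WithLp.toLp 2 ((FCN.output (0 : Matrix (Fin (m + m)) (Fin w) ℝ)
        (realParts (f 0)).ofLp).eval relu (loaded w (realParts z).ofLp)) = realParts (f 0) := by
      simp [FCN.eval]
    rw [e, ← realParts_sub, norm_realParts]
    rw [dist_eq_norm, dist_zero_right] at h1
    refine h1.trans (le_trans ?_ hc)
    rw [hκ', two_mul, ← Nat.cast_add]
    gcongr
    simpa using h2
  · rw [not_le, hκ'] at hc
    set a : ℝ := K / ε with ha
    have ha0 : 0 ≤ a := by positivity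
    have hca : 1 ≤ a * √(2 * n) := by
      rw [ha, div_mul_eq_mul_div, one_le_div hε]; exact hc.le
    set s : ℝ := √(m * n) with hs
    have hs2 : s ^ 2 = m * n := Real.sq_sqrt (by positivity)
    have hns : √(2 * n) ≤ 2 * s := by
      rw [Real.sqrt_le_left (by positivity), mul_pow, hs2]
      have : (1 : ℝ) ≤ m := by exact_mod_cast hm0
      nlinarith [(Nat.cast_nonneg n : (0 : ℝ) ≤ n)]
    have has : 1 ≤ 2 * (a * s) := by nlinarith
    -- The Euclidean error is at most `√(2m) * 2 κ / N = 4 K s / N`, which is at most `ε` once `N ≥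
    -- 4 a s`. Since `2 a s ≥ 1`, rounding up gives at most `6 a s`, whence the `36` in `gridDepth`.
    set N : ℕ := ⌈4 * (a * s)⌉₊ with hN
    have hN1 : 4 * (a * s) ≤ N := Nat.le_ceil _
    have hN2 : (N : ℝ) ≤ 6 * (a * s) := by
      have := Nat.ceil_lt_add_one (a := 4 * (a * s)) (by linarith)
      linarith
    have hN3 : (N : ℝ) ^ 2 ≤ 36 * a ^ 2 * m * n := by
      calc (N : ℝ) ^ 2 ≤ (6 * (a * s)) ^ 2 := by gcongr
        _ = _ := by rw [mul_pow, mul_pow, hs2]; ring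
    have hN0 : 0 < N := by
      have : (0 : ℝ) < N := by linarith
      exact_mod_cast this
    obtain ⟨Ψ, h1, h2, h3⟩ := FCN.exists_approx_loaded hw hg hN0
    refine ⟨Ψ, h1, Or.inr ⟨?_, ?_⟩, fun z hz => ?_⟩
    · have h5 : 1 ≤ (a * √(2 * n)) ^ 2 := one_le_pow₀ hca
      rwa [mul_pow, Real.sq_sqrt (by positivity), mul_comm] at h5
    · rw [h2, gridDepth]
      push_cast
      rw [← two_mul (n : ℕ), pow_mul]
      have h6 : ((N : ℝ) ^ 2) ^ n ≤ (36 * a ^ 2 * m * n) ^ n := by gcongr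
      calc (1 : ℝ) + (m + m) * (((N : ℝ) ^ 2) ^ n * (n + n + (n + n) + 1))
          ≤ 1 + (m + m) * ((36 * a ^ 2 * m * n) ^ n * (n + n + (n + n) + 1)) := by gcongr
        _ = _ := by ring
    · have h4 := h3 _ (realParts_mem_closedBall hz)
      simp only [ofRealParts_realParts] at h4
      refine (EuclideanSpace.norm_le_sqrt_mul (c := 2 * κ / N) (by positivity)
        fun j => ?_).trans ?_
      · rw [PiLp.sub_apply, abs_sub_comm]
        exact h4 j
      · have e : √((m + m : ℕ) : ℝ) * √(2 * n) = 2 * s := by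
          rw [← Real.sqrt_mul (by positivity), hs, ← Real.sqrt_sq (zero_le_two (α := ℝ)),
            ← Real.sqrt_mul (by positivity)]
          congr 1
          push_cast
          rw [Real.sqrt_sq zero_le_two]
          ring
        have hK : (K : ℝ) = a * ε := by rw [ha]; field_simp
        rw [mul_div_assoc', div_le_iff₀ (by positivity), hκ']
        calc √((m + m : ℕ) : ℝ) * (2 * (K * √(2 * n)))
            = 2 * K * (√((m + m : ℕ) : ℝ) * √(2 * n)) := by ring
          _ = ε * (4 * (a * s)) := by rw [e, hK]; ring
          _ ≤ ε * N := by gcongr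

theorem exists_cvnn_of_registers {n m w : ℕ} (hw : n + n + (m + m) + 1 ≤ w) {Ψ : FCN ℝ w (m + m)}
    (hΨ : Ψ.width ≤ w) : ∃ Φ : FCN ℂ n m, Φ.width = w ∧ Φ.depth = Ψ.depth + 1 ∧
      ∀ z ∈ complexCube n,
        realParts (cvnn Φ z) = WithLp.toLp 2 (Ψ.eval relu (loaded w (realParts z).ofLp)) := by
  -- The output layer recombines the real outputs as `y j + I * y (m + j)`.
  let V : Matrix (Fin m) (Fin (m + m)) ℂ :=
    Matrix.of fun j => Fin.append (Pi.single j 1) (Pi.single j Complex.I)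
  have hV : ∀ (y : Fin (m + m) → ℝ), V.mulVec (fun i => (y i : ℂ)) = (ofRealParts y).ofLp := by
    intro y
    ext j
    rw [Matrix.mulVec, dotProduct, Fin.sum_univ_add]
    simp only [V, Matrix.of_apply, Fin.append_left, Fin.append_right, Pi.single_apply, ite_mul,
      one_mul, zero_mul, Finset.sum_ite_eq', Finset.mem_univ, if_true]
    apply Complex.ext <;> simp [ofRealParts, -Fin.natAdd_eq_addNat]
  refine ⟨.hidden (Matrix.of fun (r : Fin w) (i : Fin n) => if r.val = i.val then (1 : ℂ) else
      if r.val = n + i.val then -Complex.I else 0) (fun _ => Complex.mk 1 (-2))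
      (Ψ.ofReal.postcomp V), ?_, ?_, fun z hz => ?_⟩
  · have h1 := FCN.postcomp_width V Ψ.ofReal
    have h2 := FCN.le_width (Ψ.ofReal.postcomp V)
    rw [FCN.ofReal_width] at h1
    simp only [FCN.width]
    omega
  · rw [FCN.depth, FCN.postcomp_depth, FCN.ofReal_depth]
  · rw [cvnn, FCN.eval, FCN.postcomp_eval]
    simp only [crelu_eq_loaded hz]
    rw [FCN.ofReal_eval, hV, WithLp.toLp_ofLp, realParts_ofRealParts]

theorem exists_rvnn_of_registers {n m w : ℕ} (hw : n + n + (m + m) + 1 ≤ w)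
    {Ψ : FCN ℝ w (m + m)} (hΨ : Ψ.width ≤ w) :
    ∃ Φ : FCN ℝ (n + n) (m + m), Φ.width = w ∧ Φ.depth = Ψ.depth + 1 ∧
      ∀ z ∈ complexCube n,
        rvnn Φ (realParts z) = WithLp.toLp 2 (Ψ.eval relu (loaded w (realParts z).ofLp)) := by
  refine ⟨.hidden (Matrix.of fun (r : Fin w) (i : Fin (n + n)) =>
    if r.val = i.val then (1 : ℝ) else 0) 1 Ψ, ?_, rfl, fun z hz => ?_⟩
  · have h2 := FCN.le_width Ψ
    simp only [FCN.width]
    omega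
  · rw [rvnn, FCN.eval]
    simp only [relu_eq_loaded (realParts_mem_closedBall hz)]

theorem theorem1 :
    ∃ C : ℝ, 0 < C ∧
      ∀ n : ℕ, 1 ≤ n → ∀ K : ℝ≥0, 0 < K → ∀ ε : ℝ, 0 < ε →
        -- every `K`-Lipschitz map is `ε`-approximated by a CVNN and, after separating real and
        -- imaginary parts, by an RVNN, with depths of the two orders
        (∀ m : ℕ, 1 ≤ m →
          ∀ f : EuclideanSpace ℂ (Fin n) → EuclideanSpace ℂ (Fin m),
            LipschitzOnWith K f (complexCube n) →
              (∃ Φ : FCN ℂ n m,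
                Φ.width = 2 * n + 2 * m + 1 ∧
                (Φ.depth : ℝ) ≤ C * cvnnDepthOrder n m K ε ∧
                ∀ z ∈ complexCube n, ‖f z - cvnn Φ z‖ ≤ ε) ∧
              (∃ Φ : FCN ℝ (n + n) (m + m),
                Φ.width = 2 * n + 2 * m + 2 ∧
                (Φ.depth : ℝ) ≤ C * max 1 (rvnnDepthOrder n m K ε) ∧
                ∀ z ∈ complexCube n, ‖realParts (f z) - rvnn Φ (realParts z)‖ ≤ ε)) ∧
        -- for large `m` the first order is smaller than the second one, by any constant factor
        (∀ c : ℝ, 0 < c → ∃ M : ℕ, ∀ m : ℕ, M ≤ m →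
          cvnnDepthOrder n m K ε < c * rvnnDepthOrder n m K ε) := by
  -- The summand `2` pays for the loading and output layers, and alone covers the constant network.
  -- It needs an order at least `1`: automatic in the complex case because of the `9`, and the
  -- reason for `max 1` in the real case.
  refine ⟨5 * Real.exp 144 + 2, by positivity, fun n hn K hK ε hε => ⟨fun m hm f hf =>
    ⟨?_, ?_⟩, fun c hc => cvnnDepthOrder_lt_rvnnDepthOrder hn hK hε hc⟩⟩
  · obtain ⟨Ψ, hΨ, hd, he⟩ := hf.exists_net hm (w := 2 * n + 2 * m + 1) (by omega) hε
    obtain ⟨Φ, hw, hd', he'⟩ := exists_cvnn_of_registers (n := n) (by omega) hΨ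
    refine ⟨Φ, hw, ?_, fun z hz => ?_⟩
    · have h1 : 1 ≤ cvnnDepthOrder n m K ε := by
        refine one_le_pow₀ ?_
        have : 0 ≤ 144 * m * (K : ℝ) ^ 2 * (n + 2) ^ 2 / ε ^ 2 := by positivity
        linarith
      have hE := Real.exp_pos 144
      rw [hd']
      rcases hd with hd | ⟨ha, hd⟩
      · rw [hd]; push_cast; nlinarith
      · have h2 := gridDepth_le_complex hn hm ha
        rw [show (144 * m * ((K : ℝ) / ε) ^ 2 * (n + 2) ^ 2 + 9) ^ (2 * n)
          = cvnnDepthOrder n m K ε by rw [cvnnDepthOrder, div_pow]; ring_nf] at h2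
        push_cast
        linarith
    · rw [← norm_realParts, realParts_sub, he' z hz]
      exact he z hz
  -- The construction needs only `2n + 2m + 1` registers; the additional one stays idle.
  · obtain ⟨Ψ, hΨ, hd, he⟩ := hf.exists_net hm (w := 2 * n + 2 * m + 2) (by omega) hε
    obtain ⟨Φ, hw, hd', he'⟩ := exists_rvnn_of_registers (n := n) (by omega) hΨ
    refine ⟨Φ, hw, ?_, fun z hz => ?_⟩
    · have h1 := le_max_left 1 (rvnnDepthOrder n m K ε)
      have h3 := le_max_right 1 (rvnnDepthOrder n m K ε)
      have hE := Real.exp_pos 144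
      rw [hd']
      rcases hd with hd | ⟨ha, hd⟩
      · rw [hd]; push_cast; nlinarith
      · have h2 := gridDepth_le_real hn hm (div_pos (NNReal.coe_pos.2 hK) hε) ha
        rw [show 2 * m * (2 * m * ((K : ℝ) / ε) * (1 + n / 2)) ^ (4 * n)
          = rvnnDepthOrder n m K ε by rw [rvnnDepthOrder]; ring_nf] at h2
        have h4 : 5 * Real.exp 144 * rvnnDepthOrder n m K ε
          ≤ 5 * Real.exp 144 * max 1 (rvnnDepthOrder n m K ε) := by gcongr
        push_cast
        linarith
    · rw [he' z hz]
      exact he z hz
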